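/- Let $n\ge 0$, let $F_n$ be the free group on an ordered basis $(x_1,\dots,x_n)$, and for any group $G$ let $\Gamma_1(G)=G$, $\Gamma_{k+1}(G)=[\Gamma_k(G),G]$ be its lower central series. Let $IA_n\le\operatorname{Aut}(F_n)$ be the group of automorphisms acting trivially on the abelianization $F_n^{ab}$. For $k\ge 1$ let $\mathcal A_k\le\operatorname{Aut}(F_n)$ be the group of automorphisms acting trivially on $F_n/\Gamma_{k+1}(F_n)$ and, for a subgroup $K\le \operatorname{Aut}(F_n)$, let $$\mathcal A_k(K,\Gamma_*(F_n))=\{\sigma\in K : \sigma(g)g^{-1}\in\Gamma_{i+k}(F_n)\ \text{for all } i\ge 1 \text{ and } g\in\Gamma_i(F_n)\}.$$ Let $P\Sigma_n^+$ be the triangular McCool group, that is, the group of automorphisms $\varphi$ of $F_n$ such that for every $i$ there is $w_i\in\langle x_1,\dots,x_{i-1}\rangle$ with $\varphi(x_i)=w_i^{-1}x_iw_i$. Then $P\Sigma_n^+$ satisfies the Andreadakis equality: for every $k\ge 1$, $$\Gamma_k(P\Sigma_n^+)=\Gamma_k(IA_n)\cap P\Sigma_n^+=\mathcal A_k\cap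 P\Sigma_n^+=\mathcal A_k(P\Sigma_n^+,\Gamma_*(F_n)).$$ -/

import Mathlib

namespace Andreadakis

/-- The term `Γ_k(S)`, `k ≥ 1`, of the lower central series of a group `S`, given as a subgroup of
an ambient group `G`: `Γ_1(S) = S` and `Γ_{k+1}(S) = [Γ_k(S), S]`. (Mathlib's series starts with
index `0`. The value at `k = 0`, which is never used, is `S`.) -/
def lcs {G : Type*} [Group G] (S : Subgroup G) (k : ℕ) : Subgroup G :=
  S.lowerCentralSeries (k - 1)

theorem apply_mem_lcs_top {G : Type*} [Group G] (σ : MulAut G) {k : ℕ} {g : G}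
    (hg : g ∈ lcs (⊤ : Subgroup G) k) : σ g ∈ lcs (⊤ : Subgroup G) k := by
  have h : ((⊤ : Subgroup G).lowerCentralSeries (k - 1)).Characteristic := inferInstance
  have h2 := Subgroup.characteristic_iff_le_comap.mp h σ
  exact h2 hg

/-- `IA_G`: the group of automorphisms of `G` acting trivially on the abelianization of `G`. -/
def IA (G : Type*) [Group G] : Subgroup (MulAut G) where
  carrier := {σ | ∀ g : G, Abelianization.of (σ g) = Abelianization.of g}
  one_mem' := fun _ => rfl
  mul_mem' := by
    intro σ τ hσ hτ g
    exact (hσ (τ g)).trans (hτ g)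
  inv_mem' := by
    intro σ hσ g
    have h := hσ (σ⁻¹ g)
    rw [MulAut.apply_inv_self] at h
    exact h.symm

/-- The automorphisms `σ` of `G` such that `[σ, Γ_i(G)] ⊆ Γ_m(G)`, where `[σ, g] = σ(g) g⁻¹`, i.e.
`σ` maps each element of `Γ_i(G)` to an element with the same class modulo `Γ_m(G)`. -/
def trivialOn (G : Type*) [Group G] (i m : ℕ) : Subgroup (MulAut G) where
  carrier := {σ | ∀ g ∈ lcs (⊤ : Subgroup G) i, σ g * g⁻¹ ∈ lcs (⊤ : Subgroup G) m}
  one_mem' := by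
    intro g _
    simp [one_mem]
  mul_mem' := by
    intro σ τ hσ hτ g hg
    have h1 := apply_mem_lcs_top σ (hτ g hg)
    have h2 := mul_mem h1 (hσ g hg)
    simpa [mul_assoc] using h2
  inv_mem' := by
    intro σ hσ g hg
    have h1 := apply_mem_lcs_top σ⁻¹ (inv_mem (hσ g hg))
    simpa using h1

/-- The `j`-th term of the Andreadakis filtration of `G`: the automorphisms of `G` acting trivially
on `G / Γ_{j+1}(G)`. -/
def andreadakis (G : Type*) [Group G] (j : ℕ) : Subgroup (MulAut G) :=
  trivialOn G 1 (j + 1)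

/-- `𝒜_j(K, Γ_*(G))` for a group `K` of automorphisms of `G`: the elements `σ` of `K` such that
`[σ, Γ_i(G)] ⊆ Γ_{i+j}(G)` for all `i ≥ 1`. -/
def andreadakisOn {G : Type*} [Group G] (K : Subgroup (MulAut G)) (j : ℕ) : Subgroup (MulAut G) :=
  K ⊓ ⨅ (i : ℕ) (_ : 1 ≤ i), trivialOn G i (i + j)

theorem mem_andreadakis {G : Type*} [Group G] {j : ℕ} {σ : MulAut G} :
    σ ∈ andreadakis G j ↔ ∀ g : G, σ g * g⁻¹ ∈ lcs (⊤ : Subgroup G) (j + 1) :=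
  ⟨fun h g => h g (Subgroup.mem_top g), fun h g _ => h g⟩

theorem mem_andreadakisOn {G : Type*} [Group G] {K : Subgroup (MulAut G)} {j : ℕ} {σ : MulAut G} :
    σ ∈ andreadakisOn K j ↔ σ ∈ K ∧ ∀ i, 1 ≤ i → ∀ g ∈ lcs (⊤ : Subgroup G) i,
      σ g * g⁻¹ ∈ lcs (⊤ : Subgroup G) (i + j) := by
  simp only [andreadakisOn, Subgroup.mem_inf, Subgroup.mem_iInf]
  rfl

/-- The subgroup of the free group on `x_0, …, x_{n-1}` generated by the `x_j` with `j < i`. -/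
def initial {n : ℕ} (i : Fin n) : Subgroup (FreeGroup (Fin n)) :=
  Subgroup.closure (FreeGroup.of '' {j | j < i})

/-- `φ` is a triangular basis-conjugating automorphism: `φ(x_i) = w_i⁻¹ x_i w_i` for every `i`, with
`w_i` in the subgroup generated by the `x_j`, `j < i`. -/
def IsTriangularConj {n : ℕ} (φ : MulAut (FreeGroup (Fin n))) : Prop :=
  ∀ i : Fin n, ∃ w ∈ initial i, φ (FreeGroup.of i) = w⁻¹ * FreeGroup.of i * w

theorem initial_apply_mem {n : ℕ} {φ : MulAut (FreeGroup (Fin n))} {i : Fin n}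
    (h : ∀ j < i, ∃ w ∈ initial j, φ (FreeGroup.of j) = w⁻¹ * FreeGroup.of j * w)
    {g : FreeGroup (Fin n)} (hg : g ∈ initial i) : φ g ∈ initial i := by
  have hle : initial i ≤ (initial i).comap φ.toMonoidHom := by
    refine (Subgroup.closure_le _).mpr ?_
    rintro _ ⟨j, hj, rfl⟩
    obtain ⟨w, hw, he⟩ := h j hj
    have hw' : w ∈ initial i :=
      Subgroup.closure_mono (Set.image_mono fun k (hk : k < j) => hk.trans hj) hw
    have hx : FreeGroup.of j ∈ initial i := Subgroup.subset_closure ⟨j, hj, rfl⟩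
    change φ (FreeGroup.of j) ∈ initial i
    rw [he]
    exact mul_mem (mul_mem (inv_mem hw') hx) hw'
  exact hle hg

/-- The triangular McCool group `PΣ_n^+`. -/
def triangularMcCool (n : ℕ) : Subgroup (MulAut (FreeGroup (Fin n))) where
  carrier := {φ | IsTriangularConj φ}
  one_mem' := fun i => ⟨1, one_mem _, by simp⟩
  mul_mem' := by
    intro φ ψ hφ hψ i
    obtain ⟨v, hv, hev⟩ := hφ i
    obtain ⟨w, hw, hew⟩ := hψ i
    refine ⟨v * φ w, mul_mem hv (initial_apply_mem (fun j _ => hφ j) hw), ?_⟩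
    rw [MulAut.mul_apply, hew]
    simp [hev, mul_assoc]
  inv_mem' := by
    intro φ hφ i
    induction i using WellFoundedLT.induction with
    | ind i ih =>
      obtain ⟨w, hw, he⟩ := hφ i
      refine ⟨(φ⁻¹ w)⁻¹, inv_mem (initial_apply_mem ih hw), ?_⟩
      apply φ.injective
      simp [he, mul_assoc]

end Andreadakis

/-! The inclusions `Γ_k(PΣ) ≤ Γ_k(IA) ⊓ PΣ ≤ 𝒜_k ⊓ PΣ` are formal: `PΣ ≤ IA = 𝒜_1`, and the
Andreadakis filtration satisfies `[𝒜_a, 𝒜_b] ≤ 𝒜_{a+b}`. The equality with `𝒜_k(PΣ, Γ_*)` holds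
because acting trivially modulo `Γ_{k+1}` already forces a shift by `k` on every `Γ_i`
(`andreadakis_apply_mem`). The content is `𝒜_k ⊓ PΣ ≤ Γ_k(PΣ)`.

Let `φ(x_i) = w_i⁻¹ x_i w_i` lie in `𝒜_k`. Then `[x_i, w_i⁻¹] ∈ Γ_{k+1}`. Since `w_i` does not
involve `x_i`, its leading Magnus coefficient can commute with `x_i` only if it vanishes, so `w_i ∈
Γ_k(F_n)` (`mem_lcs_of_commutator_mem`). A retraction puts `w_i` in `Γ_k⟨x_j : j < i⟩`
(`mem_lcs_initial`). As `w ↦ (x_i ↦ w⁻¹ x_i w)` is a homomorphism into `PΣ`, each such factor lies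
in `Γ_k(PΣ)`, and `φ` is a product of these factors (`mem_lcs_triangularMcCool`).

The step from vanishing Magnus coefficients to membership in `Γ_{m+1}` is Magnus' theorem, obtained
from Lazard elimination: generators of least weight are eliminated one at a time, in the group and
in the free associative algebra in parallel, until all weights exceed `m`
(`mem_lcs_succ_of_leading_eq_zero`). No Hall basis is needed. -/

namespace Andreadakis

open scoped commutatorElement

/-! ### Commutator calculus and the lower central series -/

section Commutators

variable {G : Type*} [Group G]

theorem commutator_mem_iff_commute {N : Subgroup G} [N.Normal] {x y : G} :
    ⁅x, y⁆ ∈ N ↔ Commute (x : G ⧸ N) (y : G ⧸ N) := by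
  rw [← commutatorElement_eq_one_iff_commute, ← QuotientGroup.eq_one_iff]
  rfl

/-- In `G ⧸ N` the hypothesis says that generators commute, and commuting is stable under products
and inverses. -/
theorem commutator_closure_le {X Y : Set G} {N : Subgroup G} [N.Normal]
    (h : ∀ x ∈ X, ∀ y ∈ Y, ⁅x, y⁆ ∈ N) :
    ⁅Subgroup.closure X, Subgroup.closure Y⁆ ≤ N := by
  rw [Subgroup.commutator_le]
  intro g hg g' hg'
  rw [commutator_mem_iff_commute]
  induction hg using Subgroup.closure_induction with
  | mem x hx =>
    induction hg' using Subgroup.closure_induction with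
    | mem y hy => exact commutator_mem_iff_commute.mp (h x hx y hy)
    | one => exact Commute.one_right _
    | mul y z _ _ h1 h2 => exact h1.mul_right h2
    | inv y _ h1 => exact h1.inv_right
  | one => exact Commute.one_left _
  | mul y z _ _ h1 h2 => exact h1.mul_left h2
  | inv y _ h1 => exact h1.inv_left

/-- The three subgroups lemma, applied in `G ⧸ N`. -/
theorem commutator_commutator_le_of_rotate {H₁ H₂ H₃ N : Subgroup G} [N.Normal]
    (h1 : ⁅⁅H₂, H₃⁆, H₁⁆ ≤ N) (h2 : ⁅⁅H₃, H₁⁆, H₂⁆ ≤ N) : ⁅⁅H₁, H₂⁆, H₃⁆ ≤ N := by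
  have key : ∀ H : Subgroup G, H ≤ N ↔ H.map (QuotientGroup.mk' N) = ⊥ := fun H => by
    rw [Subgroup.map_eq_bot_iff, QuotientGroup.ker_mk']
  rw [key, Subgroup.map_commutator, Subgroup.map_commutator] at *
  exact Subgroup.commutator_commutator_eq_bot_of_rotate h1 h2

theorem lcs_one (S : Subgroup G) : lcs S 1 = S := rfl

theorem lcs_succ (S : Subgroup G) {k : ℕ} (hk : 1 ≤ k) : lcs S (k + 1) = ⁅lcs S k, S⁆ := by
  obtain ⟨k, rfl⟩ := Nat.exists_eq_add_of_le' hk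
  rfl

theorem lcs_mono {S T : Subgroup G} (h : S ≤ T) (k : ℕ) : lcs S k ≤ lcs T k :=
  Subgroup.lowerCentralSeries_mono _ h

theorem lcs_antitone (S : Subgroup G) : Antitone (lcs S) := fun _ _ h =>
  S.lowerCentralSeries_antitone (Nat.sub_le_sub_right h 1)

theorem map_lcs {H : Type*} [Group H] (f : G →* H) (S : Subgroup G) (k : ℕ) :
    (lcs S k).map f = lcs (S.map f) k :=
  Subgroup.map_lowerCentralSeries S f _

instance lcs_top_normal (k : ℕ) : (lcs (⊤ : Subgroup G) k).Normal :=
  inferInstanceAs ((⊤ : Subgroup G).lowerCentralSeries (k - 1)).Normal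

theorem commutator_lcs_top_le (k : ℕ) :
    ⁅lcs (⊤ : Subgroup G) k, (⊤ : Subgroup G)⁆ ≤ lcs (⊤ : Subgroup G) (k + 1) := by
  rcases Nat.eq_zero_or_pos k with rfl | hk
  · exact le_top
  · exact (lcs_succ _ hk).ge

/-- Induction on `b` with the three subgroups lemma. Index `0` is harmless: `Γ_0 = Γ_1 = G`, and
`Γ_a` is normal. -/
theorem commutator_lcs_lcs_le (a b : ℕ) :
    ⁅lcs (⊤ : Subgroup G) a, lcs (⊤ : Subgroup G) b⁆ ≤ lcs (⊤ : Subgroup G) (a + b) := by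
  induction b generalizing a with
  | zero => exact Subgroup.commutator_le_left _ _
  | succ b ih =>
    rcases Nat.eq_zero_or_pos b with rfl | hb
    · exact commutator_lcs_top_le a
    rw [lcs_succ _ hb, Subgroup.commutator_comm]
    apply commutator_commutator_le_of_rotate
    · rw [Subgroup.commutator_comm ⊤]
      refine (Subgroup.commutator_mono (commutator_lcs_top_le a) le_rfl).trans ?_
      have := ih (a + 1)
      rwa [add_right_comm, add_assoc] at this
    · exact (Subgroup.commutator_mono (ih a) le_rfl).trans (commutator_lcs_top_le (a + b))

theorem commutator_mem_lcs {a b : ℕ} {x y : G} (hx : x ∈ lcs (⊤ : Subgroup G) a)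
    (hy : y ∈ lcs (⊤ : Subgroup G) b) : ⁅x, y⁆ ∈ lcs (⊤ : Subgroup G) (a + b) :=
  commutator_lcs_lcs_le a b (Subgroup.commutator_mem_commutator hx hy)

end Commutators

/-! ### Weighted commutators and Lazard elimination in a group -/

section WeightedCommutators

variable {G : Type*} [Group G] {S : Type*}

/-- The iterated commutators of total weight `m` in the elements `g s` of weight `d s`. -/
inductive IsWeightedCommutator (g : S → G) (d : S → ℕ) : ℕ → G → Prop
  | gen (s : S) : IsWeightedCommutator g d (d s) (g s)
  | comm {a b : ℕ} {x y : G} : IsWeightedCommutator g d a x → IsWeightedCommutator g d b y →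
      IsWeightedCommutator g d (a + b) ⁅x, y⁆

/-- The subgroup generated by `Γ_{m+1}(G)` and the iterated commutators of weight `m`. -/
def weightedSpan (g : S → G) (d : S → ℕ) (m : ℕ) : Subgroup G :=
  Subgroup.closure ({x | IsWeightedCommutator g d m x} ∪ lcs (⊤ : Subgroup G) (m + 1))

variable {g : S → G} {d : S → ℕ}

theorem IsWeightedCommutator.mem_lcs (hg : ∀ s, g s ∈ lcs (⊤ : Subgroup G) (d s)) {m : ℕ} {x : G}
    (hx : IsWeightedCommutator g d m x) : x ∈ lcs (⊤ : Subgroup G) m := by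
  induction hx with
  | gen s => exact hg s
  | comm _ _ h1 h2 => exact commutator_mem_lcs h1 h2

theorem IsWeightedCommutator.mem_weightedSpan {m : ℕ} {x : G}
    (hx : IsWeightedCommutator g d m x) : x ∈ weightedSpan g d m :=
  Subgroup.subset_closure (Or.inl hx)

theorem lcs_succ_le_weightedSpan (g : S → G) (d : S → ℕ) (m : ℕ) :
    lcs (⊤ : Subgroup G) (m + 1) ≤ weightedSpan g d m :=
  fun _ hx => Subgroup.subset_closure (Or.inr hx)

theorem weightedSpan_le_lcs (hg : ∀ s, g s ∈ lcs (⊤ : Subgroup G) (d s)) (m : ℕ) :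
    weightedSpan g d m ≤ lcs (⊤ : Subgroup G) m := by
  refine (Subgroup.closure_le _).mpr ?_
  rintro x (hx | hx)
  · exact hx.mem_lcs hg
  · exact lcs_antitone _ m.le_succ hx

/-- `Γ_m / Γ_{m+1}` is central in `G / Γ_{m+1}`, so each of its subgroups is normal there. -/
theorem normal_of_lcs_le {N : Subgroup G} {m : ℕ} (h1 : lcs (⊤ : Subgroup G) (m + 1) ≤ N)
    (h2 : N ≤ lcs (⊤ : Subgroup G) m) : N.Normal :=
  Subgroup.commutator_top_right_le_iff.mp
    ((Subgroup.commutator_mono h2 le_rfl).trans ((commutator_lcs_top_le m).trans h1))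

theorem weightedSpan_normal (hg : ∀ s, g s ∈ lcs (⊤ : Subgroup G) (d s)) (m : ℕ) :
    (weightedSpan g d m).Normal :=
  normal_of_lcs_le (lcs_succ_le_weightedSpan g d m) (weightedSpan_le_lcs hg m)

/-- A commutator with an entry from `Γ_{a+1}` or `Γ_{b+1}` has weight above `a + b`, so only pairs
in `X × Y` matter. -/
theorem commutator_closure_union_lcs_le {X Y : Set G} {a b : ℕ} {N : Subgroup G} [N.Normal]
    (hX : X ⊆ lcs (⊤ : Subgroup G) a) (hY : Y ⊆ lcs (⊤ : Subgroup G) b)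
    (hN : lcs (⊤ : Subgroup G) (a + b + 1) ≤ N) (h : ∀ x ∈ X, ∀ y ∈ Y, ⁅x, y⁆ ∈ N) :
    ⁅Subgroup.closure (X ∪ lcs (⊤ : Subgroup G) (a + 1)),
      Subgroup.closure (Y ∪ lcs (⊤ : Subgroup G) (b + 1))⁆ ≤ N := by
  apply commutator_closure_le
  rintro x (hx | hx) y (hy | hy)
  · exact h x hx y hy
  · exact hN (lcs_antitone _ (by omega) (commutator_mem_lcs (hX hx) hy))
  · exact hN (lcs_antitone _ (by omega) (commutator_mem_lcs hx (hY hy)))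
  · exact hN (lcs_antitone _ (by omega) (commutator_mem_lcs hx hy))

theorem commutator_weightedSpan_le (hg : ∀ s, g s ∈ lcs (⊤ : Subgroup G) (d s)) (a b : ℕ) :
    ⁅weightedSpan g d a, weightedSpan g d b⁆ ≤ weightedSpan g d (a + b) := by
  have := weightedSpan_normal hg (a + b)
  apply commutator_closure_union_lcs_le (fun x hx => hx.mem_lcs hg) (fun x hx => hx.mem_lcs hg)
    (lcs_succ_le_weightedSpan g d (a + b))
  intro x hx y hy
  exact (hx.comm hy).mem_weightedSpan

/-- The lower central series is spanned by the iterated commutators of a generating family. -/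
theorem lcs_le_weightedSpan_one (h : Subgroup.closure (Set.range g) = ⊤) {m : ℕ} (hm : 1 ≤ m) :
    lcs (⊤ : Subgroup G) m ≤ weightedSpan g (fun _ => 1) m := by
  induction m, hm using Nat.le_induction with
  | base =>
    rw [lcs_one, ← h]
    refine Subgroup.closure_mono ?_
    rintro _ ⟨s, rfl⟩
    exact Or.inl (IsWeightedCommutator.gen (d := fun _ => 1) s)
  | succ m hm ih =>
    have h1 : (⊤ : Subgroup G) ≤ weightedSpan g (fun _ => 1) 1 := by
      rw [← h]
      refine Subgroup.closure_mono ?_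
      rintro _ ⟨s, rfl⟩
      exact Or.inl (IsWeightedCommutator.gen (d := fun _ => 1) s)
    rw [lcs_succ _ hm]
    exact (Subgroup.commutator_mono ih h1).trans
      (commutator_weightedSpan_le (fun s => Subgroup.mem_top _) m 1)

/-- The family `[g s₀, [g s₀, …, [g s₀, g s]…]]`, `s ≠ s₀`, obtained by eliminating `s₀`. -/
def elimGen (g : S → G) (s₀ : S) (t : ℕ × {s // s ≠ s₀}) : G :=
  (fun y => ⁅g s₀, y⁆)^[t.1] (g t.2)

/-- The weights of `elimGen`. -/
def elimWeight (d : S → ℕ) (s₀ : S) (t : ℕ × {s // s ≠ s₀}) : ℕ :=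
  t.1 * d s₀ + d t.2

theorem elimGen_succ (g : S → G) (s₀ : S) (i : ℕ) (s : {s // s ≠ s₀}) :
    elimGen g s₀ (i + 1, s) = ⁅g s₀, elimGen g s₀ (i, s)⁆ :=
  Function.iterate_succ_apply' _ _ _

theorem elimWeight_succ (d : S → ℕ) (s₀ : S) (i : ℕ) (s : {s // s ≠ s₀}) :
    elimWeight d s₀ (i + 1, s) = d s₀ + elimWeight d s₀ (i, s) := by
  simp only [elimWeight]; ring

theorem elimGen_mem_lcs (hg : ∀ s, g s ∈ lcs (⊤ : Subgroup G) (d s)) (s₀ : S)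
    (t : ℕ × {s // s ≠ s₀}) : elimGen g s₀ t ∈ lcs (⊤ : Subgroup G) (elimWeight d s₀ t) := by
  obtain ⟨i, s⟩ := t
  induction i with
  | zero => simpa [elimGen, elimWeight] using hg s
  | succ i ih =>
    rw [elimGen_succ, elimWeight_succ]
    exact commutator_mem_lcs (hg s₀) ih

/-- Modulo higher terms, bracketing with `g s₀` is a derivation, and it maps the family `elimGen` to
itself. The Leibniz rule is supplied by the three subgroups lemma. -/
theorem commutator_elim_mem (hg : ∀ s, g s ∈ lcs (⊤ : Subgroup G) (d s)) (s₀ : S) {m : ℕ} {y : G}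
    (hy : IsWeightedCommutator (elimGen g s₀) (elimWeight d s₀) m y) :
    ⁅g s₀, y⁆ ∈ weightedSpan (elimGen g s₀) (elimWeight d s₀) (d s₀ + m) := by
  have hg' := elimGen_mem_lcs hg s₀
  induction hy with
  | gen t =>
    obtain ⟨i, s⟩ := t
    rw [← elimGen_succ, ← elimWeight_succ]
    exact (IsWeightedCommutator.gen (i + 1, s)).mem_weightedSpan
  | @comm a b u v hu hv ihu ihv =>
    have hN := weightedSpan_normal hg'
    have hNab := hN (d s₀ + (a + b))
    -- Cyclic subgroups turn the three subgroups lemma into a statement about elements.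
    have hzp : ∀ x y : G, ∀ N : Subgroup G, N.Normal → ⁅x, y⁆ ∈ N →
        ⁅Subgroup.zpowers x, Subgroup.zpowers y⁆ ≤ N := by
      intro x y N _ h
      rw [Subgroup.zpowers_eq_closure, Subgroup.zpowers_eq_closure]
      apply commutator_closure_le
      rintro _ rfl _ rfl
      exact h
    have h1 : ⁅⁅Subgroup.zpowers v, Subgroup.zpowers (g s₀)⁆, Subgroup.zpowers u⁆ ≤
        weightedSpan (elimGen g s₀) (elimWeight d s₀) (d s₀ + (a + b)) := by
      rw [Subgroup.commutator_comm (Subgroup.zpowers v)]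
      have := commutator_weightedSpan_le hg' (d s₀ + b) a
      rw [add_assoc, add_comm b] at this
      refine (Subgroup.commutator_mono (hzp _ _ _ (hN _) ihv) ?_).trans this
      exact Subgroup.zpowers_le.mpr hu.mem_weightedSpan
    have h2 : ⁅⁅Subgroup.zpowers (g s₀), Subgroup.zpowers u⁆, Subgroup.zpowers v⁆ ≤
        weightedSpan (elimGen g s₀) (elimWeight d s₀) (d s₀ + (a + b)) := by
      have := commutator_weightedSpan_le hg' (d s₀ + a) b
      rw [add_assoc] at this
      refine (Subgroup.commutator_mono (hzp _ _ _ (hN _) ihu) ?_).trans this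
      exact Subgroup.zpowers_le.mpr hv.mem_weightedSpan
    have h3 := commutator_commutator_le_of_rotate h1 h2
    rw [Subgroup.commutator_comm] at h3
    exact h3 (Subgroup.commutator_mem_commutator (Subgroup.mem_zpowers _)
      (Subgroup.commutator_mem_commutator (Subgroup.mem_zpowers _) (Subgroup.mem_zpowers _)))

/-- Lazard elimination: modulo `Γ_{m+1}(G)`, iterated commutators in the `g s` are products of
powers of `g s₀` and of iterated commutators in the family `elimGen g s₀`. -/
theorem weightedSpan_le_elim (hg : ∀ s, g s ∈ lcs (⊤ : Subgroup G) (d s)) (s₀ : S) {m : ℕ} :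
    weightedSpan g d m ≤ weightedSpan (elimGen g s₀) (elimWeight d s₀) m ⊔
      Subgroup.closure {x | m = d s₀ ∧ x = g s₀} := by
  have hg' := elimGen_mem_lcs hg s₀
  have hN := weightedSpan_normal hg'
  let X : ℕ → Set G := fun m =>
    {x | IsWeightedCommutator (elimGen g s₀) (elimWeight d s₀) m x} ∪ {x | m = d s₀ ∧ x = g s₀}
  have hX : ∀ m, X m ⊆ lcs (⊤ : Subgroup G) m := by
    rintro m x (hx | ⟨rfl, rfl⟩)
    · exact hx.mem_lcs hg'
    · exact hg s₀
  have hK : ∀ m, weightedSpan (elimGen g s₀) (elimWeight d s₀) m ⊔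
      Subgroup.closure {x | m = d s₀ ∧ x = g s₀} =
      Subgroup.closure (X m ∪ lcs (⊤ : Subgroup G) (m + 1)) := by
    intro m
    rw [weightedSpan, ← Subgroup.closure_union, Set.union_right_comm]
  have hcomm : ∀ a b, ⁅Subgroup.closure (X a ∪ lcs (⊤ : Subgroup G) (a + 1)),
      Subgroup.closure (X b ∪ lcs (⊤ : Subgroup G) (b + 1))⁆ ≤
      weightedSpan (elimGen g s₀) (elimWeight d s₀) (a + b) := by
    intro a b
    have := hN (a + b)
    apply commutator_closure_union_lcs_le (hX a) (hX b) (lcs_succ_le_weightedSpan _ _ _)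
    rintro x (hx | ⟨rfl, rfl⟩) y (hy | ⟨rfl, rfl⟩)
    · exact (hx.comm hy).mem_weightedSpan
    · rw [← commutatorElement_inv, add_comm]
      exact inv_mem (commutator_elim_mem hg s₀ hx)
    · exact commutator_elim_mem hg s₀ hy
    · rw [commutatorElement_self]
      exact one_mem _
  refine (Subgroup.closure_le _).mpr ?_
  rintro x (hx | hx)
  · rw [SetLike.mem_coe, hK]
    induction hx with
    | gen s =>
      by_cases hs : s = s₀
      · subst hs
        exact Subgroup.subset_closure (Or.inl (Or.inr ⟨rfl, rfl⟩))
      · have := IsWeightedCommutator.gen (g := elimGen g s₀) (d := elimWeight d s₀) (0, ⟨s, hs⟩)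
        simp only [elimGen, elimWeight, zero_mul, zero_add, Function.iterate_zero, id] at this
        exact Subgroup.subset_closure (Or.inl (Or.inl this))
    | @comm a b x y _ _ ihx ihy =>
      rw [← hK]
      exact Subgroup.mem_sup_left (hcomm a b (Subgroup.commutator_mem_commutator ihx ihy))
  · exact Subgroup.mem_sup_left (lcs_succ_le_weightedSpan _ _ _ hx)

end WeightedCommutators

/-! ### Elimination in the free associative algebra -/

section FreeAlgebraElimination

variable {σ S : Type*}

/-- The homomorphism `x ↦ x + ε δ(x)` for the derivation `δ` with `δ(ι (i, s)) = ι (i + 1, s)`. -/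
noncomputable def shiftHom (σ : Type*) : FreeAlgebra ℤ (ℕ × σ) →ₐ[ℤ]
    TrivSqZeroExt (FreeAlgebra ℤ (ℕ × σ)) (FreeAlgebra ℤ (ℕ × σ)) :=
  FreeAlgebra.lift ℤ fun t => TrivSqZeroExt.inl (FreeAlgebra.ι ℤ t) +
    TrivSqZeroExt.inr (FreeAlgebra.ι ℤ (t.1 + 1, t.2))

theorem fst_shiftHom (x : FreeAlgebra ℤ (ℕ × σ)) : (shiftHom σ x).fst = x := by
  induction x using FreeAlgebra.induction with
  | grade0 r => simp
  | grade1 t => simp [shiftHom]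
  | mul a b ha hb => rw [map_mul, TrivSqZeroExt.fst_mul, ha, hb]
  | add a b ha hb => rw [map_add, TrivSqZeroExt.fst_add, ha, hb]

/-- The derivation with `ι (i, s) ↦ ι (i + 1, s)`, as an additive endomorphism. -/
noncomputable def shiftDerivation (σ : Type*) : Module.End ℤ (FreeAlgebra ℤ (ℕ × σ)) where
  toFun x := (shiftHom σ x).snd
  map_add' x y := by rw [map_add, TrivSqZeroExt.snd_add]
  map_smul' r x := by rw [map_smul, TrivSqZeroExt.snd_smul]; rfl

theorem shiftDerivation_one : shiftDerivation σ 1 = 0 := by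
  change (shiftHom σ 1).snd = 0
  rw [map_one, TrivSqZeroExt.snd_one]

theorem shiftDerivation_ι (i : ℕ) (s : σ) :
    shiftDerivation σ (FreeAlgebra.ι ℤ (i, s)) = FreeAlgebra.ι ℤ (i + 1, s) := by
  change (shiftHom σ _).snd = _
  simp [shiftHom]

theorem shiftDerivation_mul (x y : FreeAlgebra ℤ (ℕ × σ)) : shiftDerivation σ (x * y) =
    x * shiftDerivation σ y + shiftDerivation σ x * y := by
  change (shiftHom σ _).snd = x * (shiftHom σ _).snd + (shiftHom σ _).snd * y
  rw [map_mul, TrivSqZeroExt.snd_mul, fst_shiftHom, fst_shiftHom]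
  rfl

/-- The homomorphism `ι (i, s) ↦ ad(ι s₀)^i (ι s)`. -/
noncomputable def elimHom (s₀ : S) :
    FreeAlgebra ℤ (ℕ × {s // s ≠ s₀}) →ₐ[ℤ] FreeAlgebra ℤ S :=
  FreeAlgebra.lift ℤ fun t => (fun y => ⁅FreeAlgebra.ι ℤ s₀, y⁆)^[t.1] (FreeAlgebra.ι ℤ t.2.1)

open Classical in
/-- The representation of the free algebra on `S` on that on `ℕ × (S \ {s₀})` in which `s₀` acts as
the shift derivation and the other generators act by left multiplication. -/
noncomputable def elimRep (s₀ : S) :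
    FreeAlgebra ℤ S →ₐ[ℤ] Module.End ℤ (FreeAlgebra ℤ (ℕ × {s // s ≠ s₀})) :=
  FreeAlgebra.lift ℤ fun s => if h : s = s₀ then shiftDerivation _ else
    LinearMap.mulLeft ℤ (FreeAlgebra.ι ℤ (0, ⟨s, h⟩))

/-- For a derivation `δ`, `[δ, L_x] = L_{δ x}`. Hence the image of `ad(s₀)^i(s)` acts as left
multiplication by the generator `(i, s)`. -/
theorem elimRep_elimHom (s₀ : S) (f : FreeAlgebra ℤ (ℕ × {s // s ≠ s₀})) :
    elimRep s₀ (elimHom s₀ f) = Algebra.lmul ℤ _ f := by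
  rw [← AlgHom.comp_apply]
  congr 1
  ext ⟨i, s⟩ : 2
  simp only [AlgHom.coe_comp, Function.comp_apply]
  induction i with
  | zero =>
    simp [elimHom, elimRep, s.2]
    rfl
  | succ i ih =>
    have h1 : elimHom s₀ (FreeAlgebra.ι ℤ (i + 1, s)) =
        ⁅FreeAlgebra.ι ℤ s₀, elimHom s₀ (FreeAlgebra.ι ℤ (i, s))⁆ := by
      simp only [elimHom, FreeAlgebra.lift_ι_apply, Function.iterate_succ_apply']
    have h2 : elimRep s₀ (FreeAlgebra.ι ℤ s₀) = shiftDerivation _ := by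
      simp [elimRep]
    rw [h1, Ring.lie_def, map_sub, map_mul, map_mul, ih, h2, ← shiftDerivation_ι]
    refine LinearMap.ext fun x => ?_
    change shiftDerivation _ (_ * x) - _ * shiftDerivation _ x = shiftDerivation _ _ * x
    rw [shiftDerivation_mul, add_sub_cancel_left]

/-- Letting the relation act on `1` kills the `s₀` term, as `δ(1) = 0`, and leaves `f`. -/
theorem elim_linearIndependent {s₀ : S} {c : ℤ} {f : FreeAlgebra ℤ (ℕ × {s // s ≠ s₀})}
    (h : c • FreeAlgebra.ι ℤ s₀ + elimHom s₀ f = 0) : c = 0 ∧ f = 0 := by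
  have hf : f = 0 := by
    have h2 : elimRep s₀ (FreeAlgebra.ι ℤ s₀) = shiftDerivation _ := by
      simp [elimRep]
    have h1 := LinearMap.congr_fun (congrArg (elimRep s₀) h) 1
    rw [map_add, map_zsmul, h2, elimRep_elimHom, map_zero] at h1
    change c • shiftDerivation _ 1 + f * 1 = 0 at h1
    rwa [shiftDerivation_one, smul_zero, zero_add, mul_one] at h1
  refine ⟨?_, hf⟩
  rw [hf, map_zero, add_zero] at h
  -- Sending every generator to `1` reads off `c`.
  simpa using congrArg (FreeAlgebra.lift ℤ fun _ : S => (1 : ℤ)) h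

theorem elimHom_injective (s₀ : S) : Function.Injective (elimHom s₀) :=
  (injective_iff_map_eq_zero _).mpr fun f hf =>
    (elim_linearIndependent (c := 0) (by rw [zero_smul, zero_add, hf])).2

end FreeAlgebraElimination

/-! ### Leading terms and independence under elimination -/

section LeadingTerm

variable {G A : Type*} [Group G] [Ring A]

/-- A morphism of graded Lie rings from the associated graded of the lower central series of `G` to
an associative ring, given by functions `Γ_m(G) → A`. -/
structure IsLeadingTerm (π : ℕ → G → A) : Prop where
  mul : ∀ {m : ℕ}, 1 ≤ m → ∀ {u v : G}, u ∈ lcs (⊤ : Subgroup G) m → v ∈ lcs (⊤ : Subgroup G) m →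
    π m (u * v) = π m u + π m v
  eq_zero : ∀ {m : ℕ}, 1 ≤ m → ∀ {u : G}, u ∈ lcs (⊤ : Subgroup G) (m + 1) → π m u = 0
  comm : ∀ {a b : ℕ}, 1 ≤ a → 1 ≤ b → ∀ {u v : G}, u ∈ lcs (⊤ : Subgroup G) a →
    v ∈ lcs (⊤ : Subgroup G) b → π (a + b) ⁅u, v⁆ = ⁅π a u, π b v⁆

/-- The leading term as a homomorphism on `Γ_m(G)`. -/
def IsLeadingTerm.hom {π : ℕ → G → A} (hπ : IsLeadingTerm π) {m : ℕ} (hm : 1 ≤ m) :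
    lcs (⊤ : Subgroup G) m →* Multiplicative A :=
  MonoidHom.mk' (fun u => Multiplicative.ofAdd (π m u)) fun u v => by
    simp [hπ.mul hm u.2 v.2]

theorem IsLeadingTerm.one {π : ℕ → G → A} (hπ : IsLeadingTerm π) {m : ℕ} (hm : 1 ≤ m) :
    π m 1 = 0 :=
  map_one (hπ.hom hm)

theorem IsLeadingTerm.inv {π : ℕ → G → A} (hπ : IsLeadingTerm π) {m : ℕ} (hm : 1 ≤ m) {u : G}
    (hu : u ∈ lcs (⊤ : Subgroup G) m) : π m u⁻¹ = -π m u :=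
  map_inv (hπ.hom hm) ⟨u, hu⟩

theorem IsLeadingTerm.zpow {π : ℕ → G → A} (hπ : IsLeadingTerm π) {m : ℕ} (hm : 1 ≤ m) {u : G}
    (hu : u ∈ lcs (⊤ : Subgroup G) m) (c : ℤ) : π m (u ^ c) = c • π m u :=
  map_zpow (hπ.hom hm) ⟨u, hu⟩ c

section Family

variable {π : ℕ → G → A} {S : Type*} {g : S → G} {d : S → ℕ}

theorem IsWeightedCommutator.le_weight {e m : ℕ} {x : G} (h : ∀ s, e ≤ d s)
    (hx : IsWeightedCommutator g d m x) : e ≤ m := by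
  induction hx with
  | gen s => exact h s
  | comm _ _ h1 h2 => omega

theorem leading_mem_range (hπ : IsLeadingTerm π) (hd : ∀ s, 1 ≤ d s)
    (hg : ∀ s, g s ∈ lcs (⊤ : Subgroup G) (d s)) {m : ℕ} (hm : 1 ≤ m) {w : G}
    (hw : w ∈ weightedSpan g d m) :
    π m w ∈ (FreeAlgebra.lift ℤ fun s => π (d s) (g s)).range := by
  have hle := weightedSpan_le_lcs hg m
  unfold weightedSpan at hw hle
  induction hw using Subgroup.closure_induction with
  | mem x hx =>
    rcases hx with hx | hx
    · clear hle hm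
      induction hx with
      | gen s => exact ⟨FreeAlgebra.ι ℤ s, FreeAlgebra.lift_ι_apply _ _⟩
      | comm hx hy ihx ihy =>
        rw [hπ.comm (hx.le_weight hd) (hy.le_weight hd) (hx.mem_lcs hg) (hy.mem_lcs hg),
          Ring.lie_def]
        exact sub_mem (mul_mem ihx ihy) (mul_mem ihy ihx)
    · rw [hπ.eq_zero hm hx]
      exact zero_mem _
  | one =>
    rw [hπ.one hm]
    exact zero_mem _
  | mul x y hx hy ihx ihy =>
    rw [hπ.mul hm (hle hx) (hle hy)]
    exact add_mem ihx ihy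
  | inv x hx ihx =>
    rw [hπ.inv hm (hle hx)]
    exact neg_mem ihx

theorem one_le_elimWeight (hd : ∀ s, 1 ≤ d s) (s₀ : S) (t : ℕ × {s // s ≠ s₀}) :
    1 ≤ elimWeight d s₀ t :=
  le_add_left (hd t.2)

/-- Leading terms turn group commutators into ring commutators, so elimination in the group matches
`elimHom`; injectivity is thereby inherited by the new family. -/
theorem leading_elimGen (hπ : IsLeadingTerm π) (hd : ∀ s, 1 ≤ d s)
    (hg : ∀ s, g s ∈ lcs (⊤ : Subgroup G) (d s)) (s₀ : S) :
    (FreeAlgebra.lift ℤ fun t => π (elimWeight d s₀ t) (elimGen g s₀ t)) =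
      (FreeAlgebra.lift ℤ fun s => π (d s) (g s)).comp (elimHom s₀) := by
  ext ⟨i, s⟩ : 2
  simp only [AlgHom.coe_comp, Function.comp_apply, elimHom, FreeAlgebra.lift_ι_apply]
  induction i with
  | zero => simp [elimGen, elimWeight]
  | succ i ih =>
    rw [elimGen_succ, elimWeight_succ, hπ.comm (hd s₀) (one_le_elimWeight hd s₀ _) (hg s₀)
      (elimGen_mem_lcs hg s₀ _), ih, Function.iterate_succ_apply', Ring.lie_def, Ring.lie_def,
      map_sub, map_mul, map_mul, FreeAlgebra.lift_ι_apply]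

/-- Elimination writes `w` as `w' * g s₀ ^ c`, the power occurring only in weight `d s₀`. Vanishing
of the leading term becomes a relation in the free algebra, which forces `c = 0`. -/
theorem mem_weightedSpan_elimGen (hπ : IsLeadingTerm π) (hd : ∀ s, 1 ≤ d s)
    (hg : ∀ s, g s ∈ lcs (⊤ : Subgroup G) (d s))
    (hinj : Function.Injective (FreeAlgebra.lift ℤ fun s => π (d s) (g s))) (s₀ : S)
    {m : ℕ} (hm : 1 ≤ m) {w : G} (hw : w ∈ weightedSpan g d m) (h0 : π m w = 0) :
    w ∈ weightedSpan (elimGen g s₀) (elimWeight d s₀) m := by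
  have hg' := elimGen_mem_lcs hg s₀
  have := weightedSpan_normal hg' m
  obtain ⟨w', hw', z, hz, rfl⟩ := Subgroup.mem_sup_of_normal_left.mp (weightedSpan_le_elim hg s₀ hw)
  have hz' : z = 1 ∨ m = d s₀ ∧ ∃ c : ℤ, g s₀ ^ c = z := by
    by_cases hmd : m = d s₀
    · right
      simp only [hmd, true_and, Set.ofPred_eq_eq_singleton] at hz
      exact ⟨hmd, Subgroup.mem_closure_singleton.mp hz⟩
    · left
      simpa [hmd] using hz
  rcases hz' with rfl | ⟨rfl, c, rfl⟩
  · simpa using hw'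
  obtain ⟨f, hf⟩ := leading_mem_range hπ (one_le_elimWeight hd s₀) hg' hm hw'
  rw [hπ.mul hm (weightedSpan_le_lcs hg' _ hw') (zpow_mem (hg s₀) c), hπ.zpow hm (hg s₀), ← hf,
    leading_elimGen hπ hd hg] at h0
  have h1 : c • FreeAlgebra.ι ℤ s₀ + elimHom s₀ f = 0 := by
    apply hinj
    rw [map_add, map_zsmul, FreeAlgebra.lift_ι_apply, map_zero, add_comm]
    exact h0
  rw [(elim_linearIndependent h1).1]
  simpa using hw'

/-- In the minimal weight only the terms with `i = 0` survive, since each bracket with `g s₀`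
strictly raises the weight. These are the old generators other than `s₀`. -/
theorem ncard_elimWeight (hd : ∀ s, 1 ≤ d s) {m k : ℕ} (hk : ∀ s, m ≤ d s + k) {s₀ : S}
    (hs₀ : d s₀ + k = m) :
    {t | elimWeight d s₀ t + k = m}.ncard = {s | d s + k = m}.ncard - 1 := by
  rw [← Set.ncard_sdiff_singleton_of_mem (show s₀ ∈ {s | d s + k = m} from hs₀)]
  have hzero : ∀ t : ℕ × {s // s ≠ s₀}, elimWeight d s₀ t + k = m →
      t.1 = 0 ∧ d t.2 + k = m := by
    rintro ⟨i, s⟩ ht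
    dsimp only [elimWeight] at ht ⊢
    have h1 := hk s
    have h2 := hd s₀
    have h3 : i * d s₀ = 0 := by omega
    refine ⟨?_, by omega⟩
    rcases Nat.mul_eq_zero.mp h3 with h | h
    · exact h
    · omega
  have himage : {s | d s + k = m} \ {s₀} =
      (fun t : ℕ × {s // s ≠ s₀} => t.2.1) '' {t | elimWeight d s₀ t + k = m} := by
    ext s
    constructor
    · rintro ⟨hs, hne⟩
      exact ⟨(0, ⟨s, hne⟩), by simpa [elimWeight] using hs, rfl⟩
    · rintro ⟨t, ht, rfl⟩
      exact ⟨(hzero t ht).2, t.2.2⟩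
  rw [himage, Set.InjOn.ncard_image]
  intro t ht t' ht' h
  exact Prod.ext ((hzero t ht).1.trans (hzero t' ht').1.symm) (Subtype.ext h)

theorem finite_elimWeight_le (hd : ∀ s, 1 ≤ d s) {m : ℕ} (hfin : {s | d s ≤ m}.Finite) (s₀ : S) :
    {t | elimWeight d s₀ t ≤ m}.Finite := by
  refine ((Set.finite_Iic m).prod (hfin.preimage Subtype.val_injective.injOn)).subset ?_
  rintro ⟨i, s⟩ ht
  simp only [elimWeight, Set.mem_ofPred_eq] at ht
  have := Nat.le_mul_of_pos_right i (hd s₀)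
  exact ⟨show i ≤ m by omega, show d s ≤ m by omega⟩

end Family

/-- A product of iterated commutators of weight `m` in a family with algebraically independent
leading terms lies in `Γ_{m+1}(G)` if its own leading term vanishes. -/
theorem mem_lcs_succ_of_leading_eq_zero {π : ℕ → G → A} (hπ : IsLeadingTerm π) {m : ℕ}
    (hm : 1 ≤ m) (k : ℕ) : ∀ {S : Type} {g : S → G} {d : S → ℕ} (_ : ∀ s, m + 1 ≤ d s + k)
    (_ : ∀ s, 1 ≤ d s) (_ : {s | d s ≤ m}.Finite) (_ : ∀ s, g s ∈ lcs (⊤ : Subgroup G) (d s))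
    (_ : Function.Injective (FreeAlgebra.lift ℤ fun s => π (d s) (g s))) {w : G}
    (_ : w ∈ weightedSpan g d m) (_ : π m w = 0), w ∈ lcs (⊤ : Subgroup G) (m + 1) := by
  induction k with
  | zero =>
    intro S g d hk _ _ _ _ w hw _
    -- All weights exceed `m`, so there is no commutator of weight `m`.
    refine (Subgroup.closure_le _).mpr ?_ hw
    rintro x (hx | hx)
    · have := hx.le_weight hk
      omega
    · exact hx
  | succ k ih =>
    intro S g d hk hd hfin hg hinj w hw h0
    have hk' : ∀ s, m ≤ d s + k := fun s => by have := hk s; omega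
    clear hk
    -- Inner induction on the number of generators of least possible weight `m - k`; each
    -- elimination removes one, and at zero the outer hypothesis applies.
    generalize hN : {s | d s + k = m}.ncard = N
    have hsub : {s | d s + k = m} ⊆ {s | d s ≤ m} := fun s (hs : d s + k = m) =>
      show d s ≤ m by omega
    induction N generalizing S with
    | zero =>
      -- Finiteness excludes the default value `0` of `ncard` on infinite sets.
      rw [Set.ncard_eq_zero (hfin.subset hsub)] at hN
      refine ih (fun s => ?_) hd hfin hg hinj hw h0
      have h1 := hk' s
      have h2 : d s + k ≠ m := fun h => by
        have : s ∈ {s | d s + k = m} := h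
        simp [hN] at this
      omega
    | succ N ihN =>
      obtain ⟨s₀, hs₀⟩ : {s | d s + k = m}.Nonempty := by
        apply Set.nonempty_of_ncard_ne_zero
        omega
      refine ihN (one_le_elimWeight hd s₀) (finite_elimWeight_le hd hfin s₀)
        (elimGen_mem_lcs hg s₀) ?_ (mem_weightedSpan_elimGen hπ hd hg hinj s₀ hm hw h0)
        (fun t => ?_) ?_ ?_
      · rw [leading_elimGen hπ hd hg]
        rw [AlgHom.coe_comp]
        exact hinj.comp (elimHom_injective s₀)
      · have := hk' t.2
        simp only [elimWeight]
        omega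
      · rw [ncard_elimWeight hd hk' hs₀, hN]
        rfl
      · intro t (ht : _ = m)
        show _ ≤ m
        omega

end LeadingTerm

/-! ### Leading coefficients of power series representations -/

section PowerSeriesFiltration

open PowerSeries

variable {G R : Type*} [Group G] [Ring R]

/-- The elements `g` of `G` with `ν g = 1` modulo `X ^ m`. -/
def congruenceSubgroup (ν : G →* (PowerSeries R)ˣ) (m : ℕ) : Subgroup G where
  carrier := {g | ∃ c, (ν g : PowerSeries R) = 1 + X ^ m * c}
  one_mem' := ⟨0, by simp⟩
  mul_mem' := by
    rintro g h ⟨c, hc⟩ ⟨c', hc'⟩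
    refine ⟨c + c' + c * (X ^ m * c'), ?_⟩
    rw [map_mul, Units.val_mul, hc, hc']
    noncomm_ring
  inv_mem' := by
    rintro g ⟨c, hc⟩
    refine ⟨-(ν g⁻¹ : (PowerSeries R)ˣ) * c, ?_⟩
    have h : ((ν g⁻¹ : (PowerSeries R)ˣ) : PowerSeries R) * (ν g : (PowerSeries R)ˣ) = 1 := by
      rw [← Units.val_mul, ← map_mul, inv_mul_cancel, map_one, Units.val_one]
    rw [hc, mul_add, mul_one, ← mul_assoc, ← X_pow_mul, mul_assoc] at h
    rw [neg_mul, mul_neg, ← sub_eq_add_neg, ← h, add_sub_cancel_right]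

/-- In the power series ring `uv = vu + X^(a+b) (cc' - c'c)`, because the linear terms agree;
multiplying on the right by `u⁻¹v⁻¹` gives the formula. -/
theorem map_commutator_eq_one_add {ν : G →* (PowerSeries R)ˣ} {a b : ℕ} {u v : G}
    {c c' : PowerSeries R} (hc : (ν u : PowerSeries R) = 1 + X ^ a * c)
    (hc' : (ν v : PowerSeries R) = 1 + X ^ b * c') : (ν ⁅u, v⁆ : PowerSeries R) =
      1 + X ^ (a + b) * ((c * c' - c' * c) *
        ((ν (u⁻¹ * v⁻¹) : (PowerSeries R)ˣ) : PowerSeries R)) := by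
  have h1 : ((ν u * ν v : (PowerSeries R)ˣ) : PowerSeries R) =
      ((ν v * ν u : (PowerSeries R)ˣ) : PowerSeries R) + X ^ (a + b) * (c * c' - c' * c) := by
    have h2 : (X ^ a * c) * (X ^ b * c') = X ^ (a + b) * (c * c') := by
      rw [mul_assoc, ← mul_assoc c, ← X_pow_mul, mul_assoc, ← mul_assoc, pow_add]
    have h3 : (X ^ b * c') * (X ^ a * c) = X ^ (a + b) * (c' * c) := by
      rw [mul_assoc, ← mul_assoc c', ← X_pow_mul, mul_assoc, ← mul_assoc, add_comm, pow_add]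
    rw [Units.val_mul, Units.val_mul, hc, hc', mul_sub, ← h2, ← h3]
    noncomm_ring
  have h4 : ν ⁅u, v⁆ = (ν u * ν v) * ν (u⁻¹ * v⁻¹) := by
    rw [← map_mul, ← map_mul, commutatorElement_def, mul_assoc (u * v)]
  have h5 : (ν v * ν u) * ν (u⁻¹ * v⁻¹) = 1 := by
    rw [← map_mul, ← map_mul, mul_assoc, mul_inv_cancel_left, mul_inv_cancel, map_one]
  rw [h4, Units.val_mul, h1, add_mul, ← Units.val_mul, h5, Units.val_one, mul_assoc]

theorem lcs_le_congruenceSubgroup {ν : G →* (PowerSeries R)ˣ}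
    (hν : ∀ g, constantCoeff (ν g : PowerSeries R) = 1) (m : ℕ) :
    lcs (⊤ : Subgroup G) m ≤ congruenceSubgroup ν m := by
  rcases Nat.eq_zero_or_pos m with rfl | hm
  · exact fun g _ => ⟨(ν g : PowerSeries R) - 1, by simp⟩
  have h1 : ⊤ ≤ congruenceSubgroup ν 1 := by
    intro g _
    have : X ∣ (ν g : PowerSeries R) - 1 := by
      rw [X_dvd_iff, map_sub, hν, map_one, sub_self]
    obtain ⟨c, hc⟩ := this
    exact ⟨c, by rw [pow_one, ← hc, add_sub_cancel]⟩
  induction m, hm using Nat.le_induction with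
  | base => exact h1
  | succ m hm ih =>
    rw [lcs_succ _ hm, Subgroup.commutator_le]
    intro u hu v hv
    obtain ⟨c, hc⟩ := ih hu
    obtain ⟨c', hc'⟩ := h1 hv
    exact ⟨_, map_commutator_eq_one_add hc hc'⟩

theorem coeff_one_add_X_pow_mul {m : ℕ} (hm : 1 ≤ m) (c : PowerSeries R) :
    coeff m (1 + X ^ m * c) = constantCoeff c := by
  have := coeff_X_pow_mul c m 0
  rw [zero_add] at this
  rw [map_add, this, coeff_one, if_neg (by omega), zero_add, coeff_zero_eq_constantCoeff]

theorem isLeadingTerm_coeff {ν : G →* (PowerSeries R)ˣ}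
    (hν : ∀ g, constantCoeff (ν g : PowerSeries R) = 1) :
    IsLeadingTerm fun m g => coeff m (ν g : PowerSeries R) where
  mul {m} hm u v hu hv := by
    obtain ⟨c, hc⟩ := lcs_le_congruenceSubgroup hν m hu
    obtain ⟨c', hc'⟩ := lcs_le_congruenceSubgroup hν m hv
    have h : (ν (u * v) : PowerSeries R) = 1 + X ^ m * (c + c' + c * (X ^ m * c')) := by
      rw [map_mul, Units.val_mul, hc, hc']
      noncomm_ring
    rw [h, hc, hc', coeff_one_add_X_pow_mul hm, coeff_one_add_X_pow_mul hm,
      coeff_one_add_X_pow_mul hm]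
    have h0 : m ≠ 0 := by omega
    simp [h0]
  eq_zero {m} hm u hu := by
    obtain ⟨c, hc⟩ := lcs_le_congruenceSubgroup hν (m + 1) hu
    rw [hc, pow_succ, mul_assoc, coeff_one_add_X_pow_mul hm, map_mul, constantCoeff_X, zero_mul]
  comm {a b} ha hb u v hu hv := by
    obtain ⟨c, hc⟩ := lcs_le_congruenceSubgroup hν a hu
    obtain ⟨c', hc'⟩ := lcs_le_congruenceSubgroup hν b hv
    rw [map_commutator_eq_one_add hc hc', hc, hc', coeff_one_add_X_pow_mul (le_add_right ha),
      coeff_one_add_X_pow_mul ha, coeff_one_add_X_pow_mul hb, map_mul, hν, mul_one, map_sub,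
      map_mul, map_mul, Ring.lie_def]

end PowerSeriesFiltration

/-! ### Magnus expansion and commutation with a basis element -/

section Magnus

open PowerSeries

variable {S : Type*}

/-- The unit `1 + a X` of a power series ring. -/
noncomputable def oneAddMulX {R : Type*} [Ring R] (a : R) : (PowerSeries R)ˣ where
  val := 1 + X * C a
  inv := PowerSeries.mk fun n => (-a) ^ n
  val_inv := by
    ext n
    rw [add_mul, one_mul, mul_assoc, map_add]
    cases n with
    | zero => simp
    | succ n => simp [coeff_succ_X_mul, coeff_one, pow_succ']
  inv_val := by
    ext n
    rw [mul_add, mul_one, ← mul_assoc, (commute_X _).eq, mul_assoc, map_add]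
    cases n with
    | zero => simp
    | succ n => simp [coeff_succ_X_mul, coeff_one, pow_succ]

/-- The Magnus expansion `x_s ↦ 1 + x_s X`. -/
noncomputable def magnus (S : Type*) : FreeGroup S →* (PowerSeries (FreeAlgebra ℤ S))ˣ :=
  FreeGroup.lift fun s => oneAddMulX (FreeAlgebra.ι ℤ s)

theorem magnus_of (s : S) : (magnus S (FreeGroup.of s) : PowerSeries (FreeAlgebra ℤ S)) =
    1 + X * C (FreeAlgebra.ι ℤ s) := by
  rw [magnus, FreeGroup.lift_apply_of]
  rfl

theorem map_coeff_magnus_eq {R : Type*} [Ring R] [Algebra ℤ R]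
    {f f' : FreeAlgebra ℤ S →ₐ[ℤ] R} {T : Set S}
    (h : ∀ s ∈ T, f (FreeAlgebra.ι ℤ s) = f' (FreeAlgebra.ι ℤ s)) {w : FreeGroup S}
    (hw : w ∈ Subgroup.closure (FreeGroup.of '' T)) (m : ℕ) :
    f (coeff m (magnus S w : PowerSeries (FreeAlgebra ℤ S))) =
      f' (coeff m (magnus S w : PowerSeries (FreeAlgebra ℤ S))) := by
  let F : (FreeAlgebra ℤ S →ₐ[ℤ] R) → FreeGroup S →* (PowerSeries R)ˣ := fun f =>
    (Units.map (PowerSeries.map f.toRingHom).toMonoidHom).comp (magnus S)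
  have h1 : Set.EqOn (F f) (F f') (FreeGroup.of '' T) := by
    rintro _ ⟨s, hs, rfl⟩
    ext1
    change PowerSeries.map f.toRingHom (magnus S _ : PowerSeries (FreeAlgebra ℤ S)) =
      PowerSeries.map f'.toRingHom (magnus S _ : PowerSeries (FreeAlgebra ℤ S))
    rw [magnus_of]
    simp [h s hs]
  have h2 := congrArg (fun u : (PowerSeries R)ˣ => coeff m (u : PowerSeries R))
    (MonoidHom.eqOn_closure h1 hw)
  simpa [F] using h2

/-- The augmentation sends each `1 + x_s X` to `1`, hence trivialises the whole expansion. -/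
theorem algebraMapInv_coeff_magnus {m : ℕ} (hm : 1 ≤ m) (w : FreeGroup S) :
    FreeAlgebra.algebraMapInv (coeff m (magnus S w : PowerSeries (FreeAlgebra ℤ S))) = 0 := by
  let F : FreeGroup S →* (PowerSeries ℤ)ˣ :=
    (Units.map (PowerSeries.map (FreeAlgebra.algebraMapInv (R := ℤ) (X := S)).toRingHom).toMonoidHom
      ).comp (magnus S)
  have h1 : F = 1 := by
    ext s : 2
    change PowerSeries.map _ (magnus S _ : PowerSeries (FreeAlgebra ℤ S)) = 1
    rw [magnus_of]
    simp [FreeAlgebra.algebraMapInv]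
  have h2 := congrArg (fun u : (PowerSeries ℤ)ˣ => coeff m (u : PowerSeries ℤ))
    (DFunLike.congr_fun h1 w)
  have h0 : m ≠ 0 := by omega
  simpa [F, coeff_one, h0] using h2

theorem constantCoeff_magnus (w : FreeGroup S) :
    constantCoeff (magnus S w : PowerSeries (FreeAlgebra ℤ S)) = 1 := by
  have h1 : (Units.map (constantCoeff (R := FreeAlgebra ℤ S)).toMonoidHom).comp (magnus S) = 1 := by
    ext s : 2
    change constantCoeff (magnus S _ : PowerSeries (FreeAlgebra ℤ S)) = 1
    rw [magnus_of]
    simp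
  exact congrArg Units.val (DFunLike.congr_fun h1 w)

theorem isLeadingTerm_magnus (S : Type*) : IsLeadingTerm fun m (w : FreeGroup S) =>
    coeff m (magnus S w : PowerSeries (FreeAlgebra ℤ S)) :=
  isLeadingTerm_coeff constantCoeff_magnus

/-- Magnus' theorem: the lower central series of a free group is determined by the Magnus
expansion. -/
theorem mem_lcs_succ_of_coeff_magnus_eq_zero {S : Type} [Finite S] {m : ℕ} (hm : 1 ≤ m)
    {w : FreeGroup S} (hw : w ∈ lcs (⊤ : Subgroup (FreeGroup S)) m)
    (h : coeff m (magnus S w : PowerSeries (FreeAlgebra ℤ S)) = 0) :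
    w ∈ lcs (⊤ : Subgroup (FreeGroup S)) (m + 1) := by
  refine mem_lcs_succ_of_leading_eq_zero (isLeadingTerm_magnus S) hm m (g := FreeGroup.of)
    (d := fun _ => 1) (fun _ => (add_comm m 1).le) (fun _ => le_rfl) (Set.toFinite _)
    (fun _ => Subgroup.mem_top _) ?_
    (lcs_le_weightedSpan_one (FreeGroup.closure_range_of S) hm hw) h
  -- The coefficient of `X` in `1 + x_s X` is `x_s`, so this lift is the identity.
  refine Function.LeftInverse.injective (g := id) fun x => ?_
  rw [id]
  induction x using FreeAlgebra.induction with
  | grade0 r => rw [eq_intCast, map_intCast]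
  | grade1 s =>
    have := coeff_succ_X_mul 0 (C (FreeAlgebra.ι ℤ s))
    rw [zero_add] at this
    rw [FreeAlgebra.lift_ι_apply, magnus_of, map_add, this]
    simp [coeff_one]
  | mul a b ha hb => rw [map_mul, ha, hb]
  | add a b ha hb => rw [map_add, ha, hb]

/-- The homomorphism `x ↦ diag(x, ε x)`, where `ε` is the augmentation. -/
noncomputable def diagHom (S : Type*) :
    FreeAlgebra ℤ S →ₐ[ℤ] Matrix (Fin 2) (Fin 2) (FreeAlgebra ℤ S) :=
  FreeAlgebra.lift ℤ fun s => !![FreeAlgebra.ι ℤ s, 0; 0, 0]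

theorem diagHom_apply (x : FreeAlgebra ℤ S) :
    diagHom S x = !![x, 0; 0, algebraMap ℤ _ (FreeAlgebra.algebraMapInv x)] := by
  induction x using FreeAlgebra.induction with
  | grade0 r =>
    rw [AlgHom.commutes, AlgHom.commutes, Matrix.algebraMap_eq_diagonal]
    ext i j
    fin_cases i <;> fin_cases j <;> simp
  | grade1 s => simp [diagHom, FreeAlgebra.algebraMapInv]
  | mul a b ha hb => simp [ha, hb]
  | add a b ha hb => simp [ha, hb]

/-- Represent `s₀` by the matrix unit `E₁₂` and the other generators `s` by `diag(s, 0)`. The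
coefficient `c` then becomes `diag(c, 0)`, and commuting with `E₁₂` forces `c = 0`. -/
theorem coeff_magnus_eq_zero_of_commute {s₀ : S} {w : FreeGroup S}
    (hw : w ∈ Subgroup.closure (FreeGroup.of '' {s | s ≠ s₀})) {m : ℕ} (hm : 1 ≤ m)
    (h : Commute (FreeAlgebra.ι ℤ s₀) (coeff m (magnus S w : PowerSeries (FreeAlgebra ℤ S)))) :
    coeff m (magnus S w : PowerSeries (FreeAlgebra ℤ S)) = 0 := by
  classical
  let f : FreeAlgebra ℤ S →ₐ[ℤ] Matrix (Fin 2) (Fin 2) (FreeAlgebra ℤ S) :=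
    FreeAlgebra.lift ℤ fun s => if s = s₀ then !![0, 1; 0, 0] else !![FreeAlgebra.ι ℤ s, 0; 0, 0]
  have h1 : f (coeff m (magnus S w : PowerSeries (FreeAlgebra ℤ S))) =
      diagHom S (coeff m (magnus S w : PowerSeries (FreeAlgebra ℤ S))) := by
    refine map_coeff_magnus_eq (fun s hs => ?_) hw m
    rw [FreeAlgebra.lift_ι_apply, if_neg hs, diagHom, FreeAlgebra.lift_ι_apply]
  have h2 : f (FreeAlgebra.ι ℤ s₀) = !![0, 1; 0, 0] := by simp [f]
  have h3 := h.map f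
  rw [h1, h2, diagHom_apply, algebraMapInv_coeff_magnus hm, map_zero] at h3
  simpa using (congrFun (congrFun h3.eq 0) 1).symm

/-- An element of a free group not involving the basis element `x` lies in `Γ_k` as soon as its
commutator with `x` lies in `Γ_{k+1}`. -/
theorem mem_lcs_of_commutator_mem {S : Type} [Finite S] {s₀ : S} {w : FreeGroup S}
    (hw : w ∈ Subgroup.closure (FreeGroup.of '' {s | s ≠ s₀})) {k : ℕ}
    (h : ⁅FreeGroup.of s₀, w⁆ ∈ lcs (⊤ : Subgroup (FreeGroup S)) (k + 1)) :
    w ∈ lcs (⊤ : Subgroup (FreeGroup S)) k := by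
  induction k with
  | zero => exact Subgroup.mem_top w
  | succ k ih =>
    rcases Nat.eq_zero_or_pos k with rfl | hk
    · exact Subgroup.mem_top w
    have hwk := ih (lcs_antitone _ (Nat.le_succ _) h)
    refine mem_lcs_succ_of_coeff_magnus_eq_zero hk hwk
      (coeff_magnus_eq_zero_of_commute hw hk ?_)
    have h1 := (isLeadingTerm_magnus S).comm le_rfl hk
      (Subgroup.mem_top (FreeGroup.of s₀)) hwk
    rw [add_comm, (isLeadingTerm_magnus S).eq_zero (le_add_left le_rfl) h, magnus_of,
      Ring.lie_def] at h1
    have h2 := coeff_succ_X_mul 0 (C (FreeAlgebra.ι ℤ s₀))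
    rw [zero_add] at h2
    simp only [map_add, h2, coeff_one, one_ne_zero, if_false, zero_add,
      coeff_zero_eq_constantCoeff, constantCoeff_C] at h1
    exact (sub_eq_zero.mp h1.symm)

end Magnus

/-! ### The Andreadakis filtration -/

section AndreadakisFiltration

variable {G : Type*} [Group G]

theorem mem_IA_iff {σ : MulAut G} : σ ∈ IA G ↔ σ ∈ andreadakis G 1 := by
  rw [mem_andreadakis]
  refine forall_congr' fun g => ?_
  rw [eq_comm]
  change (QuotientGroup.mk g : G ⧸ commutator G) = QuotientGroup.mk (σ g) ↔ _
  rw [QuotientGroup.eq, (inferInstance : (commutator G).Normal).mem_comm_iff,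
    ← Subgroup.top_lowerCentralSeries_one]
  rfl

theorem apply_mul_inv_mem_lcs_iff {σ : MulAut G} {g : G} {j : ℕ} :
    σ g * g⁻¹ ∈ lcs (⊤ : Subgroup G) j ↔
      QuotientGroup.mk' (lcs (⊤ : Subgroup G) j) (σ g) = QuotientGroup.mk' _ g := by
  rw [← div_eq_mul_inv, ← QuotientGroup.eq_iff_div_mem]
  rfl

theorem commute_mk_lcs {x y : G} {p q m : ℕ} (hx : x ∈ lcs (⊤ : Subgroup G) p)
    (hy : y ∈ lcs (⊤ : Subgroup G) q) (h : m ≤ p + q) :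
    Commute (QuotientGroup.mk' (lcs (⊤ : Subgroup G) m) x) (QuotientGroup.mk' _ y) :=
  commutator_mem_iff_commute.mp (lcs_antitone _ h (commutator_mem_lcs hx hy))

/-- Induction on `i`. Write `σ u = a u` and `σ v = b v` with `a ∈ Γ_{i+k}`, `b ∈ Γ_{k+1}`. Modulo
`Γ_{i+1+k}`, `a` is central and `b` commutes with `u` and `[u, v]`, so `[au, bv] = [u, v]`. -/
theorem andreadakis_apply_mem {k : ℕ} {σ : MulAut G} (hσ : σ ∈ andreadakis G k) {i : ℕ}
    (hi : 1 ≤ i) {g : G} (hg : g ∈ lcs (⊤ : Subgroup G) i) :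
    σ g * g⁻¹ ∈ lcs (⊤ : Subgroup G) (i + k) := by
  rw [mem_andreadakis] at hσ
  induction i, hi using Nat.le_induction generalizing g with
  | base =>
    rw [add_comm]
    exact hσ g
  | succ i hi ih =>
    let Q := QuotientGroup.mk' (lcs (⊤ : Subgroup G) (i + 1 + k))
    have hle : lcs (⊤ : Subgroup G) (i + 1) ≤ (Q.comp σ.toMonoidHom).eqLocus Q := by
      rw [lcs_succ _ hi, Subgroup.commutator_le]
      intro u hu v _
      change Q (σ ⁅u, v⁆) = Q ⁅u, v⁆
      obtain ⟨a, ha, hau⟩ : ∃ a ∈ lcs (⊤ : Subgroup G) (i + k), σ u = a * u :=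
        ⟨_, ih hu, (inv_mul_cancel_right _ _).symm⟩
      obtain ⟨b, hb, hbv⟩ : ∃ b ∈ lcs (⊤ : Subgroup G) (k + 1), σ v = b * v :=
        ⟨_, hσ v, (inv_mul_cancel_right _ _).symm⟩
      have hcentral : ∀ y, Commute (Q a) (Q y) := fun y =>
        commute_mk_lcs (q := 1) ha (Subgroup.mem_top y) (by omega)
      have hub : Commute (Q u) (Q b) := commute_mk_lcs hu hb (by omega)
      have hbuv : Commute (Q b) (Q ⁅u, v⁆) :=
        commute_mk_lcs hb (commutator_mem_lcs hu (b := 1) (Subgroup.mem_top v)) (by omega)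
      have h1 : Q ⁅a * u, b * v⁆ = Q ⁅u, b * v⁆ := by
        rw [commutatorElement_mul_left_eq_conj_mul, map_mul, map_mul, map_mul, (hcentral _).eq,
          map_inv, mul_inv_cancel_right, map_commutatorElement Q a, (hcentral _).commutator_eq,
          mul_one]
      have h2 : Q ⁅u, b * v⁆ = Q ⁅u, v⁆ := by
        rw [commutatorElement_mul_right_eq_mul_conj, map_mul, map_mul, map_mul,
          map_commutatorElement Q u b, hub.commutator_eq, one_mul, hbuv.eq, map_inv,
          mul_inv_cancel_right]
      rw [map_commutatorElement, hau, hbv, h1, h2]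
    exact apply_mul_inv_mem_lcs_iff.mpr (hle hg)

/-- With `σ g = s g` and `τ g = t g`, modulo `Γ_{a+b+1}` the automorphism `σ` fixes `t`, `τ` fixes
`s`, and `s`, `t` commute; hence `στ` and `τσ` agree there. -/
theorem commutator_andreadakis_le {a b : ℕ} :
    ⁅andreadakis G a, andreadakis G b⁆ ≤ andreadakis G (a + b) := by
  rw [Subgroup.commutator_le]
  intro σ hσ τ hτ
  rw [mem_andreadakis]
  intro g
  let Q := QuotientGroup.mk' (lcs (⊤ : Subgroup G) (a + b + 1))
  have hmul : ∀ g, Q (σ (τ g)) = Q (τ (σ g)) := by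
    intro g
    obtain ⟨s, hs, hsg⟩ : ∃ s ∈ lcs (⊤ : Subgroup G) (a + 1), σ g = s * g :=
      ⟨_, mem_andreadakis.mp hσ g, (inv_mul_cancel_right _ _).symm⟩
    obtain ⟨t, ht, htg⟩ : ∃ t ∈ lcs (⊤ : Subgroup G) (b + 1), τ g = t * g :=
      ⟨_, mem_andreadakis.mp hτ g, (inv_mul_cancel_right _ _).symm⟩
    have h1 : Q (σ t) = Q t := apply_mul_inv_mem_lcs_iff.mp
      (lcs_antitone _ (by omega) (andreadakis_apply_mem hσ (by omega) ht))
    have h2 : Q (τ s) = Q s := apply_mul_inv_mem_lcs_iff.mp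
      (lcs_antitone _ (by omega) (andreadakis_apply_mem hτ (by omega) hs))
    have h3 : Commute (Q t) (Q s) := commute_mk_lcs ht hs (by omega)
    rw [htg, hsg, map_mul σ, map_mul τ, hsg, htg, map_mul, map_mul, map_mul, map_mul, h1, h2,
      ← mul_assoc, h3.eq, mul_assoc]
  rw [apply_mul_inv_mem_lcs_iff]
  have h := hmul (σ⁻¹ (τ⁻¹ g))
  rw [MulAut.apply_inv_self, MulAut.apply_inv_self] at h
  exact h

theorem lcs_IA_le_andreadakis {k : ℕ} (hk : 1 ≤ k) : lcs (IA G) k ≤ andreadakis G k := by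
  have h1 : IA G ≤ andreadakis G 1 := fun σ => mem_IA_iff.mp
  induction k, hk using Nat.le_induction with
  | base => exact h1
  | succ k hk ih =>
    rw [lcs_succ _ hk]
    exact (Subgroup.commutator_mono ih h1).trans commutator_andreadakis_le

theorem andreadakis_inf_eq_andreadakisOn (K : Subgroup (MulAut G)) (k : ℕ) :
    andreadakis G k ⊓ K = andreadakisOn K k := by
  ext σ
  rw [mem_andreadakisOn, Subgroup.mem_inf, and_comm]
  refine and_congr_right fun _ => ⟨fun h i hi g hg => andreadakis_apply_mem h hi hg, fun h => ?_⟩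
  rw [mem_andreadakis]
  intro g
  rw [add_comm]
  exact h 1 le_rfl g (Subgroup.mem_top g)

end AndreadakisFiltration

/-! ### Factorisation of triangular automorphisms -/

section Triangular

variable {n : ℕ}

/-- The endomorphism `x_i ↦ w⁻¹ x_i w` fixing the other basis elements. -/
def conjEnd (i : Fin n) (w : FreeGroup (Fin n)) : FreeGroup (Fin n) →* FreeGroup (Fin n) :=
  FreeGroup.lift fun j => if j = i then w⁻¹ * FreeGroup.of i * w else FreeGroup.of j

theorem conjEnd_of_self (i : Fin n) (w : FreeGroup (Fin n)) :
    conjEnd i w (FreeGroup.of i) = w⁻¹ * FreeGroup.of i * w := by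
  simp [conjEnd]

theorem conjEnd_of_ne {i j : Fin n} (h : j ≠ i) (w : FreeGroup (Fin n)) :
    conjEnd i w (FreeGroup.of j) = FreeGroup.of j := by
  simp [conjEnd, h]

theorem conjEnd_apply_of_mem {i : Fin n} (w : FreeGroup (Fin n)) {v : FreeGroup (Fin n)}
    (hv : v ∈ initial i) : conjEnd i w v = v := by
  have : Set.EqOn (conjEnd i w) (MonoidHom.id _) (FreeGroup.of '' {j | j < i}) := by
    rintro _ ⟨j, hj, rfl⟩
    exact conjEnd_of_ne (ne_of_lt hj) w
  exact MonoidHom.eqOn_closure this hv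

/-- `w` does not involve `x_i`, so it is fixed by `conjEnd i v`. -/
theorem conjEnd_comp {i : Fin n} (v : FreeGroup (Fin n)) {w : FreeGroup (Fin n)}
    (hw : w ∈ initial i) : (conjEnd i v).comp (conjEnd i w) = conjEnd i (v * w) := by
  ext j
  by_cases h : j = i
  · subst h
    simp only [MonoidHom.comp_apply, conjEnd_of_self, map_mul, map_inv,
      conjEnd_apply_of_mem v hw]
    group
  · simp only [MonoidHom.comp_apply, conjEnd_of_ne h]

theorem conjEnd_one (i : Fin n) : conjEnd i 1 = MonoidHom.id _ := by
  ext j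
  by_cases h : j = i
  · subst h
    simp [conjEnd_of_self]
  · simp [conjEnd_of_ne h]

/-- The automorphisms `x_i ↦ w⁻¹ x_i w`, `w ∈ ⟨x_j : j < i⟩`, fixing the other basis elements. -/
def conjAut (i : Fin n) : initial i →* MulAut (FreeGroup (Fin n)) where
  toFun w := MonoidHom.toMulEquiv (conjEnd i w) (conjEnd i w⁻¹)
    (by rw [conjEnd_comp _ w.2, inv_mul_cancel, conjEnd_one])
    (by rw [conjEnd_comp _ (inv_mem w.2), mul_inv_cancel, conjEnd_one])
  map_one' := by
    ext1 x
    exact DFunLike.congr_fun (conjEnd_one i) x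
  map_mul' v w := by
    ext1 x
    exact (DFunLike.congr_fun (conjEnd_comp v w.2) x).symm

theorem conjAut_apply (i : Fin n) (w : initial i) (x : FreeGroup (Fin n)) :
    conjAut i w x = conjEnd i w x := rfl

theorem range_conjAut_le (i : Fin n) : (conjAut i).range ≤ triangularMcCool n := by
  rintro _ ⟨w, rfl⟩ j
  by_cases h : j = i
  · subst h
    exact ⟨w, w.2, conjEnd_of_self j w⟩
  · exact ⟨1, one_mem _, by rw [conjAut_apply, conjEnd_of_ne h]; simp⟩

/-- The retraction killing `x_j` for `j ≥ i` fixes `w` and maps `Γ_k` of the whole group into `Γ_k`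
of its image. -/
theorem mem_lcs_initial {i : Fin n} {k : ℕ} {w : FreeGroup (Fin n)} (hw : w ∈ initial i)
    (hk : w ∈ lcs (⊤ : Subgroup (FreeGroup (Fin n))) k) : w ∈ lcs (initial i) k := by
  let r : FreeGroup (Fin n) →* FreeGroup (Fin n) :=
    FreeGroup.lift fun j => if j < i then FreeGroup.of j else 1
  have hr : Set.EqOn r (MonoidHom.id _) (FreeGroup.of '' {j | j < i}) := by
    rintro _ ⟨j, hj, rfl⟩
    simp [r, show j < i from hj]
  have hrw : r w = w := MonoidHom.eqOn_closure hr hw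
  have hrange : (⊤ : Subgroup (FreeGroup (Fin n))).map r ≤ initial i := by
    rw [← MonoidHom.range_eq_map]
    refine FreeGroup.range_lift_le ?_
    rintro _ ⟨j, rfl⟩
    dsimp only
    split_ifs with h
    · exact Subgroup.subset_closure ⟨j, h, rfl⟩
    · exact one_mem _
  have h := Subgroup.mem_map_of_mem r hk
  rw [map_lcs, hrw] at h
  exact lcs_mono hrange k h

theorem conjAut_mem_lcs {i : Fin n} {k : ℕ} {w : initial i}
    (hw : (w : FreeGroup (Fin n)) ∈ lcs (⊤ : Subgroup (FreeGroup (Fin n))) k) :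
    conjAut i w ∈ lcs (triangularMcCool n) k := by
  have h1 : (⊤ : Subgroup (initial i)).map (initial i).subtype = initial i := by
    rw [← MonoidHom.range_eq_map, Subgroup.range_subtype]
  have h2 := map_lcs (initial i).subtype ⊤ k
  rw [h1] at h2
  obtain ⟨w', hw', h⟩ := h2.ge (mem_lcs_initial w.2 hw)
  obtain rfl : w' = w := Subtype.ext h
  have h3 := Subgroup.mem_map_of_mem (conjAut i) hw'
  rw [map_lcs, ← MonoidHom.range_eq_map] at h3
  exact lcs_mono (range_conjAut_le i) k h3

theorem triangularMcCool_le_IA : triangularMcCool n ≤ IA (FreeGroup (Fin n)) := by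
  intro φ hφ
  have h : (Abelianization.of.comp φ.toMonoidHom : FreeGroup (Fin n) →* _) =
      Abelianization.of := by
    ext i
    obtain ⟨w, _, he⟩ := hφ i
    change Abelianization.of (φ _) = _
    rw [he, map_mul, map_mul, map_inv, mul_right_comm, inv_mul_cancel, one_mul]
  exact DFunLike.congr_fun h

/-- A triangular automorphism all of whose conjugating elements lie in `Γ_k` lies in `Γ_k` of the
triangular McCool group. -/
theorem mem_lcs_triangularMcCool {k : ℕ} (r : ℕ) : ∀ {φ : MulAut (FreeGroup (Fin n))},
    (∀ i, ∃ w ∈ initial i, w ∈ lcs (⊤ : Subgroup (FreeGroup (Fin n))) k ∧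
      φ (FreeGroup.of i) = w⁻¹ * FreeGroup.of i * w) →
    (∀ i : Fin n, r ≤ i → φ (FreeGroup.of i) = FreeGroup.of i) →
    φ ∈ lcs (triangularMcCool n) k := by
  induction r with
  | zero =>
    intro φ _ h
    have : φ.toMonoidHom = MonoidHom.id _ := by
      ext i
      exact h i (Nat.zero_le _)
    have h1 : φ = 1 := MulEquiv.ext fun x => DFunLike.congr_fun this x
    rw [h1]
    exact one_mem _
  | succ r ih =>
    intro φ hφ h
    by_cases hr : r < n
    -- The factor at the last moved index `r` is stripped off on the left; what remains fixes every
    -- `x_i` with `i ≥ r`.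
    · obtain ⟨w, hw, hwk, he⟩ := hφ ⟨r, hr⟩
      have hc := conjAut_mem_lcs (w := ⟨w, hw⟩) hwk
      have hself : ((conjAut ⟨r, hr⟩ ⟨w, hw⟩)⁻¹ * φ) (FreeGroup.of ⟨r, hr⟩) =
          FreeGroup.of ⟨r, hr⟩ := by
        rw [← map_inv, MulAut.mul_apply, he, conjAut_apply]
        simp only [map_mul, map_inv, conjEnd_of_self, conjEnd_apply_of_mem _ hw,
          InvMemClass.coe_inv]
        group
      have hother : ∀ i : Fin n, r < i → ((conjAut ⟨r, hr⟩ ⟨w, hw⟩)⁻¹ * φ) (FreeGroup.of i) =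
          FreeGroup.of i := by
        intro i hi
        rw [← map_inv, MulAut.mul_apply, h i hi, conjAut_apply, conjEnd_of_ne]
        exact (Fin.ne_of_lt hi).symm
      have key : (conjAut ⟨r, hr⟩ ⟨w, hw⟩)⁻¹ * φ ∈ lcs (triangularMcCool n) k := by
        apply ih
        · intro i
          rcases lt_trichotomy i ⟨r, hr⟩ with hi | rfl | hi
          · obtain ⟨v, hv, hvk, hev⟩ := hφ i
            refine ⟨v, hv, hvk, ?_⟩
            -- For `i < r` the image of `x_i` does not involve `x_r`, so the stripped factor leaves
            -- it and its conjugating element unchanged.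
            have hmem : φ (FreeGroup.of i) ∈ initial ⟨r, hr⟩ := by
              refine initial_apply_mem (fun j _ => ?_) (Subgroup.subset_closure ⟨i, hi, rfl⟩)
              obtain ⟨u, hu, _, heu⟩ := hφ j
              exact ⟨u, hu, heu⟩
            rw [← map_inv, MulAut.mul_apply, conjAut_apply, conjEnd_apply_of_mem _ hmem, hev]
          · exact ⟨1, one_mem _, one_mem _, by rw [hself]; simp⟩
          · exact ⟨1, one_mem _, one_mem _, by rw [hother i hi]; simp⟩
        · intro i hi
          rcases hi.eq_or_lt with hi | hi
          · obtain rfl : i = ⟨r, hr⟩ := Fin.ext hi.symm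
            exact hself
          · exact hother i hi
      simpa using mul_mem hc key
    · exact ih hφ fun i hi => absurd i.2 (by omega)

theorem andreadakis_inf_triangularMcCool_le (k : ℕ) :
    andreadakis (FreeGroup (Fin n)) k ⊓ triangularMcCool n ≤ lcs (triangularMcCool n) k := by
  rintro φ ⟨hk, hφ⟩
  refine mem_lcs_triangularMcCool n (fun i => ?_) fun i hi => absurd i.2 (by omega)
  obtain ⟨w, hw, he⟩ := hφ i
  refine ⟨w, hw, ?_, he⟩
  have h := mem_andreadakis.mp hk (FreeGroup.of i)
  have h1 : φ (FreeGroup.of i) * (FreeGroup.of i)⁻¹ = ⁅FreeGroup.of i, w⁻¹⁆⁻¹ := by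
    rw [he, commutatorElement_inv, commutatorElement_def, inv_inv]
  rw [h1, inv_mem_iff] at h
  rw [← inv_mem_iff]
  refine mem_lcs_of_commutator_mem (inv_mem ?_) h
  exact Subgroup.closure_mono (Set.image_mono fun j (hj : j < i) => ne_of_lt hj) hw

end Triangular

end Andreadakis

theorem corollary5p4 (n : ℕ) (k : ℕ) (hk : 1 ≤ k) :
    Andreadakis.lcs (Andreadakis.triangularMcCool n) k =
        Andreadakis.lcs (Andreadakis.IA (FreeGroup (Fin n))) k ⊓ Andreadakis.triangularMcCool n ∧
    Andreadakis.lcs (Andreadakis.IA (FreeGroup (Fin n))) k ⊓ Andreadakis.triangularMcCool n =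
        Andreadakis.andreadakis (FreeGroup (Fin n)) k ⊓ Andreadakis.triangularMcCool n ∧
    Andreadakis.andreadakis (FreeGroup (Fin n)) k ⊓ Andreadakis.triangularMcCool n =
        Andreadakis.andreadakisOn (Andreadakis.triangularMcCool n) k := by
  have h1 : Andreadakis.lcs (Andreadakis.triangularMcCool n) k ≤
      Andreadakis.lcs (Andreadakis.IA (FreeGroup (Fin n))) k ⊓ Andreadakis.triangularMcCool n :=
    le_inf (Andreadakis.lcs_mono Andreadakis.triangularMcCool_le_IA k)
      (Andreadakis.lcs_antitone _ hk)
  have h2 := inf_le_inf_right (Andreadakis.triangularMcCool n)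
    (Andreadakis.lcs_IA_le_andreadakis (G := FreeGroup (Fin n)) hk)
  have h3 := Andreadakis.andreadakis_inf_triangularMcCool_le (n := n) k
  exact ⟨h1.antisymm (h2.trans h3), h2.antisymm (h3.trans h1),
    Andreadakis.andreadakis_inf_eq_andreadakisOn _ k⟩
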